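/- Let $m\ge 0$, let $a_1,\dots,a_m,b_1,\dots,b_m,c\in\mathbb{C}$ be arbitrary, and let $D=\mathbb{C}[x_1,\dots,x_m]\langle\partial_1,\dots,\partial_m\rangle$ be the ring of differential operators with polynomial coefficients (the Weyl algebra). Put $\theta_i=x_i\partial_i$ and $$\ell_i^B=\theta_i(\theta_1+\cdots+\theta_m+c-1)-x_i(\theta_i+a_i)(\theta_i+b_i)\qquad(1\le i\le m),$$ and let $I_B(m)=D\cdot\{\ell_1^B,\dots,\ell_m^B\}$ be the left ideal that they generate. For $P=\sum_{\alpha,\beta}c_{\alpha,\beta}x^\alpha\partial^\beta\in D$ nonzero, the $(\mathbf 0,\mathbf 1)$-initial form $\mathrm{in}_{(\mathbf 0,\mathbf 1)}(P)\in\mathbb{C}[x,\xi]=\mathbb{C}[x_1,\dots,x_m,\xi_1,\dots,\xi_m]$ is the sum of the $c_{\alpha,\beta}x^\alpha\xi^\beta$ over those $(\alpha,\beta)$ for which $|\beta|=\beta_1+\cdots+\beta_m$ is maximal among all pairs with $c_{\alpha,\beta}\neq 0$; also $\mathrm{in}_{(\mathbf 0,\mathbf 1)}(0)=0$. For a left ideal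 $I$ of $D$ let $\mathrm{in}_{(\mathbf 0,\mathbf 1)}(I)$ be the ideal of $\mathbb{C}[x,\xi]$ generated by all $\mathrm{in}_{(\mathbf 0,\mathbf 1)}(P)$ with $P\in I$; the characteristic variety $\mathrm{Ch}(I)\subset\mathbb{C}^{2m}$ is the set of common zeros of $\mathrm{in}_{(\mathbf 0,\mathbf 1)}(I)$. Then, for every $i$, the $(\mathbf 0,\mathbf 1)$-initial form of $\ell_i^B$ is $$L_i^B=x_i\xi_i\Bigl(x_i(1-x_i)\xi_i+\sum_{1\le j\le m,\;j\ne i}x_j\xi_j\Bigr),$$ and $$\mathrm{Ch}(I_B(m))=\mathbf{V}(L_1^B,\dots,L_m^B)=\{(x,\xi)\in\mathbb{C}^{2m} : L_1^B(x,\xi)=\cdots=L_m^B(x,\xi)=0\}.$$ -/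

import Mathlib

noncomputable section

namespace LauricellaFB

open MvPolynomial

/-- The polynomial ring `ℂ[x₁, …, x_m]`. -/
abbrev Poly (m : ℕ) : Type := MvPolynomial (Fin m) ℂ

/-- The operator of multiplication by a polynomial on `ℂ[x₁, …, x_m]`. -/
def mulOp (m : ℕ) : Poly m →ₐ[ℂ] Module.End ℂ (Poly m) := Algebra.lmul ℂ (Poly m)

/-- The operator `∂/∂x_i` on `ℂ[x₁, …, x_m]`. -/
def derivOp (m : ℕ) (i : Fin m) : Module.End ℂ (Poly m) := (pderiv i).toLinearMap

theorem mulOp_apply {m : ℕ} (p q : Poly m) : mulOp m p q = p * q := rfl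

theorem derivOp_apply {m : ℕ} (i : Fin m) (p : Poly m) : derivOp m i p = pderiv i p := rfl

/-- The Weyl algebra `D = ℂ[x₁, …, x_m]⟨∂₁, …, ∂_m⟩`: the ring of differential operators
with polynomial coefficients, realized as the algebra of operators on `ℂ[x₁, …, x_m]`
generated by the multiplications by the `x_i` and by the `∂/∂x_i`. -/
def weylAlgebra (m : ℕ) : Subalgebra ℂ (Module.End ℂ (Poly m)) :=
  Algebra.adjoin ℂ (Set.range (fun i => mulOp m (X i)) ∪ Set.range (derivOp m))

/-- The Weyl algebra as a type. -/
abbrev D (m : ℕ) : Type := weylAlgebra m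

/-- The element `x_i` of `D`. -/
def x {m : ℕ} (i : Fin m) : D m :=
  ⟨mulOp m (X i), Algebra.subset_adjoin (Or.inl ⟨i, rfl⟩)⟩

/-- The element `∂_i` of `D`. -/
def d {m : ℕ} (i : Fin m) : D m :=
  ⟨derivOp m i, Algebra.subset_adjoin (Or.inr ⟨i, rfl⟩)⟩

theorem x_commute {m : ℕ} (i j : Fin m) : Commute (x i) (x j) := by
  apply Subtype.ext
  change mulOp m (X i) * mulOp m (X j) = mulOp m (X j) * mulOp m (X i)
  rw [← map_mul, ← map_mul, mul_comm]

theorem d_commute {m : ℕ} (i j : Fin m) : Commute (d i) (d j) := by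
  apply Subtype.ext
  change derivOp m i * derivOp m j = derivOp m j * derivOp m i
  refine (basisMonomials (Fin m) ℂ).ext fun s => ?_
  simp only [coe_basisMonomials, Module.End.mul_apply, derivOp_apply, pderiv_monomial]
  by_cases h : i = j
  · rw [h]
  · have h' : j ≠ i := fun e => h e.symm
    rw [tsub_right_comm]
    congr 1
    simp [h, h', mul_comm]

theorem xPow_pairwise {m : ℕ} (α : Fin m → ℕ) :
    ((Finset.univ : Finset (Fin m)) : Set (Fin m)).Pairwise
      (Function.onFun Commute fun i => (x i : D m) ^ α i) :=
  fun i _ j _ _ => (x_commute i j).pow_pow _ _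

theorem dPow_pairwise {m : ℕ} (β : Fin m → ℕ) :
    ((Finset.univ : Finset (Fin m)) : Set (Fin m)).Pairwise
      (Function.onFun Commute fun i => (d i : D m) ^ β i) :=
  fun i _ j _ _ => (d_commute i j).pow_pow _ _

/-- The product `x^α = x₁^α₁ ⋯ x_m^α_m` in `D`. -/
def xPow {m : ℕ} (α : Fin m → ℕ) : D m :=
  Finset.univ.noncommProd (fun i => x i ^ α i) (xPow_pairwise α)

/-- The product `∂^β = ∂₁^β₁ ⋯ ∂_m^β_m` in `D`. -/
def dPow {m : ℕ} (β : Fin m → ℕ) : D m :=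
  Finset.univ.noncommProd (fun i => d i ^ β i) (dPow_pairwise β)

/-- The commutative polynomial ring `ℂ[x₁, …, x_m, ξ₁, …, ξ_m]`; the variable `x_i` has the
index `Sum.inl i`, and `ξ_i` has the index `Sum.inr i`. -/
abbrev SymbolRing (m : ℕ) : Type := MvPolynomial (Fin m ⊕ Fin m) ℂ

/-- The normally ordered monomial `x^α ∂^β` of `D`, where `s = (α, β)`. -/
def normalMonomial {m : ℕ} (s : Fin m ⊕ Fin m →₀ ℕ) : D m :=
  xPow (fun i => s (Sum.inl i)) * dPow (fun i => s (Sum.inr i))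

/-- The linear map `∑ c_{α,β} x^α ξ^β ↦ ∑ c_{α,β} x^α ∂^β`. -/
def normalOrder (m : ℕ) : SymbolRing m →ₗ[ℂ] D m :=
  (basisMonomials (Fin m ⊕ Fin m) ℂ).constr ℂ normalMonomial

theorem normalOrder_monomial {m : ℕ} (s : Fin m ⊕ Fin m →₀ ℕ) (c : ℂ) :
    normalOrder m (monomial s c) = c • normalMonomial s := by
  have h : (monomial s c : SymbolRing m) = c • basisMonomials (Fin m ⊕ Fin m) ℂ s := by
    simp [smul_monomial]
  rw [h, map_smul, normalOrder, Module.Basis.constr_basis]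

theorem xPow_val {m : ℕ} (α : Fin m →₀ ℕ) :
    ((xPow α : D m) : Module.End ℂ (Poly m)) = mulOp m (monomial α 1) := by
  have hc : ((Finset.univ : Finset (Fin m)) : Set (Fin m)).Pairwise
      (Function.onFun Commute fun i => (X i : Poly m) ^ α i) := fun i _ j _ _ => Commute.all _ _
  have h1 : (monomial α 1 : Poly m) = Finset.univ.noncommProd (fun i => X i ^ α i) hc := by
    rw [Finset.noncommProd_eq_prod, monomial_eq, Finsupp.prod_fintype _ _ (fun i => pow_zero _)]
    simp
  rw [h1, Finset.map_noncommProd]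
  change (weylAlgebra m).val (xPow α) = _
  rw [xPow, Finset.map_noncommProd]
  refine Finset.noncommProd_congr rfl (fun i _ => ?_) _
  simp [x]

theorem derivOp_pow_monomial {m : ℕ} (i : Fin m) (k : ℕ) (γ : Fin m →₀ ℕ) (c : ℂ) :
    (derivOp m i ^ k) (monomial γ c) =
      monomial (γ - Finsupp.single i k) (c * ((γ i).descFactorial k : ℂ)) := by
  induction k with
  | zero => simp
  | succ k ih =>
    rw [pow_succ', Module.End.mul_apply, ih, derivOp_apply, pderiv_monomial, tsub_tsub, ← Finsupp.single_add,
      Nat.descFactorial_succ]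
    congr 1
    simp
    ring

theorem dPow_monomial {m : ℕ} (β γ : Fin m →₀ ℕ) :
    ((dPow β : D m) : Module.End ℂ (Poly m)) (monomial γ 1) =
      monomial (γ - β) (∏ i, ((γ i).descFactorial (β i) : ℂ)) := by
  classical
  change (weylAlgebra m).val (dPow β) _ = _
  rw [dPow, Finset.map_noncommProd]
  have key : ∀ S : Finset (Fin m), ∀ hS,
      (S.noncommProd (fun i => (weylAlgebra m).val (d i ^ β i)) hS) (monomial γ 1) =
      monomial (γ - ∑ i ∈ S, Finsupp.single i (β i))
        (∏ i ∈ S, ((γ i).descFactorial (β i) : ℂ)) := by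
    intro S
    induction S using Finset.induction_on with
    | empty => intro hS; simp
    | insert a S ha ih =>
      intro hS
      rw [Finset.noncommProd_insert_of_notMem _ _ _ _ ha, Module.End.mul_apply, ih]
      have h1 : (weylAlgebra m).val (d a ^ β a) = derivOp m a ^ β a := by
        rw [map_pow]; rfl
      have h2 : (γ - ∑ i ∈ S, Finsupp.single i (β i)) a = γ a := by
        rw [Finsupp.tsub_apply, Finsupp.finsetSum_apply, Finset.sum_eq_zero, tsub_zero]
        intro i hi
        exact Finsupp.single_eq_of_ne (fun h => ha (h ▸ hi))
      rw [h1, derivOp_pow_monomial, h2, tsub_tsub, Finset.sum_insert ha, Finset.prod_insert ha,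
        add_comm, mul_comm]
  refine (key _ _).trans ?_
  rw [Finsupp.univ_sum_single]

theorem d_mul_dPow {m : ℕ} (i : Fin m) (β : Fin m →₀ ℕ) :
    d i * dPow β = dPow (β + Finsupp.single i 1 : Fin m →₀ ℕ) := by
  classical
  rw [dPow, dPow, ← Finset.mul_noncommProd_erase Finset.univ (Finset.mem_univ i)
      (fun j => d j ^ β j) (dPow_pairwise β), ← Finset.mul_noncommProd_erase Finset.univ (Finset.mem_univ i)
      (fun j => d j ^ (β + Finsupp.single i 1 : Fin m →₀ ℕ) j) (dPow_pairwise _), ← mul_assoc]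
  congr 1
  · simp [pow_succ']
  · refine Finset.noncommProd_congr rfl (fun j hj => ?_) _
    have : j ≠ i := (Finset.mem_erase.mp hj).1
    simp [this.symm]

theorem d_mul_xPow {m : ℕ} (i : Fin m) (α : Fin m →₀ ℕ) :
    d i * xPow α = xPow α * d i + (α i : ℂ) • xPow (α - Finsupp.single i 1 : Fin m →₀ ℕ) := by
  apply Subtype.ext
  change derivOp m i * (xPow α : D m).1 = (xPow α : D m).1 * derivOp m i +
    (α i : ℂ) • (xPow (α - Finsupp.single i 1 : Fin m →₀ ℕ) : D m).1
  rw [xPow_val, xPow_val]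
  refine LinearMap.ext fun p => ?_
  simp only [mulOp_apply, derivOp_apply, Module.End.mul_apply, LinearMap.add_apply,
    LinearMap.smul_apply, pderiv_mul, pderiv_monomial]
  rw [← smul_mul_assoc, smul_monomial]
  simp [add_comm]

theorem x_mul_xPow {m : ℕ} (i : Fin m) (α : Fin m →₀ ℕ) :
    x i * xPow α = xPow (α + Finsupp.single i 1 : Fin m →₀ ℕ) := by
  apply Subtype.ext
  change mulOp m (X i) * (xPow α : D m).1 = _
  rw [xPow_val, xPow_val, ← map_mul, X, monomial_mul, add_comm, one_mul]

/-- The pair `(α, β)` as one exponent. -/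
def joinExp {m : ℕ} (α β : Fin m →₀ ℕ) : Fin m ⊕ Fin m →₀ ℕ := Finsupp.sumElim α β

theorem normalMonomial_joinExp {m : ℕ} (α β : Fin m →₀ ℕ) :
    normalMonomial (joinExp α β) = xPow α * dPow β := rfl

theorem exists_joinExp {m : ℕ} (s : Fin m ⊕ Fin m →₀ ℕ) :
    ∃ α β : Fin m →₀ ℕ, s = joinExp α β := by
  refine ⟨Finsupp.equivFunOnFinite.symm fun i => s (Sum.inl i),
    Finsupp.equivFunOnFinite.symm fun i => s (Sum.inr i), ?_⟩
  ext (i | i) <;> simp [joinExp]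

theorem normalMonomial_mem {m : ℕ} (s : Fin m ⊕ Fin m →₀ ℕ) :
    normalMonomial s ∈ LinearMap.range (normalOrder m) :=
  ⟨monomial s 1, by rw [normalOrder_monomial, one_smul]⟩

theorem normalOrder_mem_of_monomial {m : ℕ} (P : D m)
    (h : ∀ s, P * normalMonomial s ∈ LinearMap.range (normalOrder m)) (p : SymbolRing m) :
    P * normalOrder m p ∈ LinearMap.range (normalOrder m) := by
  induction p using MvPolynomial.induction_on' with
  | monomial s c =>
    rw [normalOrder_monomial, mul_smul_comm]
    exact Submodule.smul_mem _ _ (h s)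
  | add p q hp hq =>
    rw [map_add, mul_add]
    exact Submodule.add_mem _ hp hq

theorem normalOrder_surjective (m : ℕ) : Function.Surjective (normalOrder m) := by
  have key : ∀ (P : Module.End ℂ (Poly m)) (hP : P ∈ weylAlgebra m) (p : SymbolRing m),
      (⟨P, hP⟩ : D m) * normalOrder m p ∈ LinearMap.range (normalOrder m) := by
    intro P hP
    induction hP using Algebra.adjoin_induction with
    | mem P hP =>
      refine normalOrder_mem_of_monomial _ fun s => ?_
      obtain ⟨α, β, rfl⟩ := exists_joinExp s
      rcases hP with ⟨i, rfl⟩ | ⟨i, rfl⟩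
      · change x i * _ ∈ _
        rw [normalMonomial_joinExp, ← mul_assoc, x_mul_xPow, ← normalMonomial_joinExp]
        exact normalMonomial_mem _
      · change d i * _ ∈ _
        rw [normalMonomial_joinExp, ← mul_assoc, d_mul_xPow, add_mul, mul_assoc, d_mul_dPow,
          smul_mul_assoc, ← normalMonomial_joinExp, ← normalMonomial_joinExp]
        exact Submodule.add_mem _ (normalMonomial_mem _)
          (Submodule.smul_mem _ _ (normalMonomial_mem _))
    | algebraMap r =>
      intro p
      refine ⟨r • p, ?_⟩
      rw [map_smul, Algebra.smul_def]
      rfl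
    | add P Q hP hQ h1 h2 =>
      intro p
      have := Submodule.add_mem _ (h1 p) (h2 p)
      rwa [← add_mul] at this
    | mul P Q hP hQ h1 h2 =>
      intro p
      obtain ⟨q, hq⟩ := h2 p
      have := h1 q
      rwa [hq, ← mul_assoc] at this
  intro P
  have h1 : normalOrder m 1 = 1 := by
    have := normalOrder_monomial (m := m) 0 1
    rw [one_smul] at this
    change normalOrder m (monomial 0 1) = 1
    rw [this]
    have hx : (xPow (fun i => (0 : Fin m ⊕ Fin m →₀ ℕ) (Sum.inl i)) : D m) = 1 :=
      (Finset.noncommProd_eq_pow_card _ _ _ 1 fun _ _ => pow_zero _).trans (one_pow _)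
    have hd : (dPow (fun i => (0 : Fin m ⊕ Fin m →₀ ℕ) (Sum.inr i)) : D m) = 1 :=
      (Finset.noncommProd_eq_pow_card _ _ _ 1 fun _ _ => pow_zero _).trans (one_pow _)
    rw [normalMonomial, hx, hd, one_mul]
  have := key P.1 P.2 1
  rw [h1, mul_one] at this
  exact this

theorem normalOrder_apply_monomial {m : ℕ} (p : SymbolRing m) (γ : Fin m →₀ ℕ) :
    ((normalOrder m p : D m) : Module.End ℂ (Poly m)) (monomial γ 1) =
      ∑ s ∈ p.support, monomial
        ((Finsupp.comapDomain Sum.inl s Sum.inl_injective.injOn) +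
          (γ - Finsupp.comapDomain Sum.inr s Sum.inr_injective.injOn))
        (coeff s p * ∏ i, ((γ i).descFactorial (s (Sum.inr i)) : ℂ)) := by
  conv_lhs => rw [p.as_sum]
  change (weylAlgebra m).val.toLinearMap (normalOrder m _) _ = _
  rw [map_sum, map_sum, LinearMap.sum_apply]
  refine Finset.sum_congr rfl fun s _ => ?_
  obtain ⟨α, β, rfl⟩ := exists_joinExp s
  have hα : Finsupp.comapDomain Sum.inl (joinExp α β) Sum.inl_injective.injOn = α := by
    ext i; simp [joinExp]
  have hβ : Finsupp.comapDomain Sum.inr (joinExp α β) Sum.inr_injective.injOn = β := by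
    ext i; simp [joinExp]
  rw [hα, hβ, normalOrder_monomial, normalMonomial_joinExp]
  change (coeff (joinExp α β) p • ((xPow α : D m).1 * (dPow β : D m).1)) (monomial γ 1) = _
  rw [LinearMap.smul_apply, Module.End.mul_apply, dPow_monomial, xPow_val, mulOp_apply,
    monomial_mul, smul_monomial, one_mul]
  rfl

theorem normalOrder_injective (m : ℕ) : Function.Injective (normalOrder m) := by
  classical
  refine (injective_iff_map_eq_zero (normalOrder m)).mpr fun p hp => ?_
  have key : ∀ n : ℕ, ∀ α β : Fin m →₀ ℕ, β.degree = n → coeff (joinExp α β) p = 0 := by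
    intro n
    induction n using Nat.strong_induction_on with
    | _ n ih =>
      intro α β hβ
      have h := normalOrder_apply_monomial p β
      rw [hp] at h
      replace h := congrArg (coeff α) h
      rw [coeff_sum] at h
      rw [Finset.sum_eq_single (joinExp α β)] at h
      · have hα : Finsupp.comapDomain Sum.inl (joinExp α β) Sum.inl_injective.injOn = α := by
          ext i; simp [joinExp]
        have hβ' : Finsupp.comapDomain Sum.inr (joinExp α β) Sum.inr_injective.injOn = β := by
          ext i; simp [joinExp]
        rw [hα, hβ', tsub_self, add_zero, coeff_monomial, if_pos rfl] at h
        have h0 : coeff (joinExp α β) p *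
            ∏ i, ((β i).descFactorial (joinExp α β (Sum.inr i)) : ℂ) = 0 := by
          rw [← h]; simp
        rcases mul_eq_zero.mp h0 with h0 | h0
        · exact h0
        · exfalso
          obtain ⟨i, -, hi⟩ := Finset.prod_eq_zero_iff.mp h0
          have : (β i).descFactorial (β i) = 0 := by exact_mod_cast hi
          rw [Nat.descFactorial_self] at this
          exact Nat.factorial_ne_zero _ this
      · intro s _ hs
        obtain ⟨α', β', rfl⟩ := exists_joinExp s
        have hα : Finsupp.comapDomain Sum.inl (joinExp α' β') Sum.inl_injective.injOn = α' := by
          ext i; simp [joinExp]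
        have hβ' : Finsupp.comapDomain Sum.inr (joinExp α' β') Sum.inr_injective.injOn = β' := by
          ext i; simp [joinExp]
        rw [hα, hβ']
        by_cases hle : β' ≤ β
        · by_cases heq : β' = β
          · subst heq
            rw [tsub_self, add_zero, coeff_monomial, if_neg]
            rintro rfl
            exact hs rfl
          · have hlt : β'.degree < n := by
              rw [← hβ, ← tsub_add_cancel_of_le hle, map_add]
              have : (β - β').degree ≠ 0 := by
                rw [Ne, Finsupp.degree_eq_zero_iff]
                intro h0
                exact heq (le_antisymm hle (tsub_eq_zero_iff_le.mp h0))
              omega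
            rw [ih _ hlt α' β' rfl]
            simp
        · have : ∃ i, β i < β' i := by
            by_contra! hcon
            exact hle hcon
          obtain ⟨i, hi⟩ := this
          rw [Finset.prod_eq_zero (Finset.mem_univ i)]
          · simp
          · have : (β i).descFactorial (β' i) = 0 := Nat.descFactorial_eq_zero_iff_lt.mpr hi
            exact_mod_cast this
      · intro hs
        rw [notMem_support_iff.mp hs]
        simp
  ext s
  obtain ⟨α, β, rfl⟩ := exists_joinExp s
  rw [key _ α β rfl, coeff_zero]

/-- Every `P ∈ D` is `∑ c_{α,β} x^α ∂^β` for exactly one polynomial `∑ c_{α,β} x^α ξ^β`. -/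
theorem normalOrder_bijective (m : ℕ) : Function.Bijective (normalOrder m) :=
  ⟨normalOrder_injective m, normalOrder_surjective m⟩

/-- The total symbol `∑ c_{α,β} x^α ξ^β` of `P = ∑ c_{α,β} x^α ∂^β`. -/
def totalSymbol {m : ℕ} (P : D m) : SymbolRing m :=
  (LinearEquiv.ofBijective (normalOrder m) (normalOrder_bijective m)).symm P

/-- The weight vector `(0, 1)`: each `x_i` has weight `0` and each `ξ_i` has weight `1`. -/
def weight01 (m : ℕ) : Fin m ⊕ Fin m → ℕ := Sum.elim (fun _ => 0) (fun _ => 1)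

/-- The `(0, 1)`-initial form of `P ∈ D`: the sum of the terms of highest `(0, 1)`-weight in
the total symbol of `P` (and `0` for `P = 0`). -/
def initialForm {m : ℕ} (P : D m) : SymbolRing m :=
  weightedHomogeneousComponent (weight01 m)
    (weightedTotalDegree (weight01 m) (totalSymbol P)) (totalSymbol P)

/-- The `(0, 1)`-initial form ideal of a left ideal `I` of `D`. -/
def initialIdeal {m : ℕ} (I : Ideal (D m)) : Ideal (SymbolRing m) :=
  Ideal.span {f | ∃ P ∈ I, f = initialForm P}

/-- The characteristic variety of a left ideal `I` of `D`, a subset of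
`ℂ^{2m} = {(x₁, …, x_m, ξ₁, …, ξ_m)}`. -/
def characteristicVariety {m : ℕ} (I : Ideal (D m)) : Set (Fin m ⊕ Fin m → ℂ) :=
  zeroLocus ℂ (initialIdeal I)

/-- The Euler operator `θ_i = x_i ∂_i`. -/
def euler {m : ℕ} (i : Fin m) : D m := x i * d i

/-- The operator
`ℓ_i^B = θ_i (θ₁ + ⋯ + θ_m + c - 1) - x_i (θ_i + a_i) (θ_i + b_i)`. -/
def ellB {m : ℕ} (a b : Fin m → ℂ) (c : ℂ) (i : Fin m) : D m :=
  euler i * (∑ j, euler j + algebraMap ℂ (D m) (c - 1)) -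
    x i * (euler i + algebraMap ℂ (D m) (a i)) * (euler i + algebraMap ℂ (D m) (b i))

/-- The left ideal `I_B(m)` of `D` generated by `ℓ_1^B, …, ℓ_m^B` (for a noncommutative ring,
`Ideal` means left ideal). -/
def idealB {m : ℕ} (a b : Fin m → ℂ) (c : ℂ) : Ideal (D m) :=
  Ideal.span (Set.range (ellB a b c))

/-- The polynomial `L_i^B = x_i ξ_i (x_i (1 - x_i) ξ_i + ∑_{j ≠ i} x_j ξ_j)`. -/
def LB {m : ℕ} (i : Fin m) : SymbolRing m :=
  X (Sum.inl i) * X (Sum.inr i) *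
    (X (Sum.inl i) * (1 - X (Sum.inl i)) * X (Sum.inr i) +
      ∑ j ∈ Finset.univ.erase i, X (Sum.inl j) * X (Sum.inr j))

end LauricellaFB

end

/-!
For the total degree in `x` and `ξ`, the leading form of `L_i` is `-x_i³ ξ_i²`. These monomials are
pairwise coprime, so they have only Koszul syzygies, and lifting syzygies of leading forms shows
that the same holds for the `L_i` themselves. The commutator `[ℓ_i, ℓ_j] = θ_i ℓ_j - θ_j ℓ_i`,
rewritten as `(ℓ_j - θ_j) ℓ_i = (ℓ_i - θ_i) ℓ_j`, lifts each Koszul relation `L_j L_i = L_i L_j` to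
the Weyl algebra, with terms of the same order. Hence the same lifting argument, now in `D`, removes
all cancellation of symbols from a representation `∑ Q_i ℓ_i` of an element of the ideal, whose
initial form is then a combination of the `L_i`.
-/

noncomputable section

namespace LauricellaFB

open MvPolynomial

section Koszul

/-- A square array which is skew-symmetric with zero diagonal. Both conditions are imposed, so
that the notion is the right one in every characteristic. -/
structure IsAlternating {ι A : Type*} [AddGroup A] (u : ι → ι → A) : Prop where
  self : ∀ i, u i i = 0
  swap : ∀ i j, u i j = -u j i

namespace IsAlternating

variable {ι A B : Type*}

theorem zero [AddGroup A] : IsAlternating (0 : ι → ι → A) := ⟨by simp, by simp⟩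

theorem add [AddCommGroup A] {u v : ι → ι → A} (hu : IsAlternating u) (hv : IsAlternating v) :
    IsAlternating (u + v) where
  self i := by simp [hu.self i, hv.self i]
  swap i j := by simp [hu.swap i j, hv.swap i j, add_comm]

theorem map {F : Type*} [AddGroup A] [AddGroup B] [FunLike F A B] [AddMonoidHomClass F A B]
    {u : ι → ι → A} (hu : IsAlternating u) (f : F) : IsAlternating fun i j => f (u i j) where
  self i := by rw [hu.self, map_zero]
  swap i j := by rw [hu.swap, map_neg]

theorem sum_sum_mul_mul_eq_zero [Fintype ι] [Ring A] {u : ι → ι → A} (hu : IsAlternating u)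
    {G P : ι → A} (h : ∀ i j, G j * P i = G i * P j) : ∑ i, (∑ j, u i j * G j) * P i = 0 := by
  simp only [Finset.sum_mul, ← Fintype.sum_prod_type']
  refine Finset.sum_ninvolution Prod.swap (fun ij => ?_) (fun ij hij hswap => hij ?_)
    (fun _ => Finset.mem_univ _) Prod.swap_swap
  · rw [Prod.fst_swap, Prod.snd_swap, hu.swap, mul_assoc, mul_assoc, h ij.1 ij.2, neg_mul,
      neg_add_cancel]
  · have hdiag : ij.1 = ij.2 := congrArg Prod.snd hswap
    rw [hdiag, hu.self, zero_mul, zero_mul]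

theorem sum_sub_sum_mul_mul [Fintype ι] [Ring A] {u : ι → ι → A} (hu : IsAlternating u)
    {G P : ι → A} (h : ∀ i j, G j * P i = G i * P j) (Q : ι → A) :
    ∑ i, (Q i - ∑ j, u i j * G j) * P i = ∑ i, Q i * P i := by
  simp only [sub_mul, Finset.sum_sub_distrib, hu.sum_sum_mul_mul_eq_zero h, sub_zero]

end IsAlternating

/-- The family `r`, restricted to `s`, has only Koszul syzygies: every relation
`∑ i ∈ s, q i * r i = 0` is a combination of the trivial relations `r j * r i - r i * r j = 0`. -/
def HasKoszulSyzygies {ι R : Type*} [CommRing R] (s : Finset ι) (r : ι → R) : Prop :=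
  ∀ q : ι → R, ∑ i ∈ s, q i * r i = 0 →
    ∃ u, IsAlternating u ∧ ∀ i ∈ s, q i = ∑ j ∈ s, u i j * r j

namespace HasKoszulSyzygies

variable {ι R : Type*} [CommRing R] {s : Finset ι} {r : ι → R}

theorem neg (h : HasKoszulSyzygies s r) : HasKoszulSyzygies s (-r) := by
  intro q hq
  obtain ⟨u, hu, hqu⟩ := h q (by simpa using hq)
  exact ⟨fun i j => -u i j, hu.map (-AddMonoidHom.id R), fun i hi => by simpa using hqu i hi⟩

theorem insert [DecidableEq ι] {a : ι} (ha : a ∉ s) (h : HasKoszulSyzygies s r)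
    (hreg : ∀ f, f * r a ∈ Ideal.span (r '' s) → f ∈ Ideal.span (r '' s)) :
    HasKoszulSyzygies (insert a s) r := by
  intro q hq
  rw [Finset.sum_insert ha] at hq
  have hqa : q a * r a ∈ Ideal.span (r '' s) := by
    rw [eq_neg_of_add_eq_zero_left hq]
    exact neg_mem (Ideal.sum_mem _ fun i hi =>
      Ideal.mul_mem_left _ _ (Ideal.subset_span ⟨i, hi, rfl⟩))
  obtain ⟨c, hc : ∑ i ∈ s, c i * r i = q a⟩ :=
    (Submodule.mem_span_image_finset_iff_exists_fun' R).mp (hreg _ hqa)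
  obtain ⟨u, hu, hqu⟩ := h (fun i => q i + c i * r a) (by
    rw [← hq, ← hc, Finset.sum_mul, ← Finset.sum_add_distrib]
    exact Finset.sum_congr rfl fun i _ => by ring)
  have hne : ∀ i ∈ s, i ≠ a := fun i hi => ne_of_mem_of_not_mem hi ha
  refine ⟨fun i j => if i = a then (if j = a then 0 else c j) else
    if j = a then -c i else u i j, ⟨fun i => ?_, fun i j => ?_⟩, fun i hi => ?_⟩
  · by_cases hi : i = a <;> simp [hi, hu.self]
  · by_cases hi : i = a <;> by_cases hj : j = a <;> simp [hi, hj, hu.swap i j]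
  · rw [Finset.sum_insert ha]
    rcases Finset.mem_insert.mp hi with rfl | hi
    · rw [← hc]
      simp only [if_true, zero_mul, zero_add]
      exact Finset.sum_congr rfl fun j hj => by rw [if_neg (hne j hj)]
    · simp only [if_true, if_neg (hne i hi)]
      rw [Finset.sum_congr rfl fun j hj => by rw [if_neg (hne j hj)], ← hqu i hi]
      ring

theorem of_nonzerodivisors (s : Finset ι)
    (h : ∀ (t : Finset ι) (a : ι), a ∉ t → ∀ f,
      f * r a ∈ Ideal.span (r '' t) → f ∈ Ideal.span (r '' t)) : HasKoszulSyzygies s r := by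
  classical
  induction s using Finset.induction_on with
  | empty => exact fun q _ => ⟨0, .zero, by simp⟩
  | insert a t ha ih => exact ih.insert ha (h t a ha)

theorem monomial {σ : Type*} (s : Finset ι) {e : ι → σ →₀ ℕ}
    (he : Pairwise fun i j => Disjoint (e i).support (e j).support) :
    HasKoszulSyzygies s fun i => MvPolynomial.monomial (e i) (1 : R) := by
  refine .of_nonzerodivisors s fun t a ha f hf => ?_
  have himage : (fun i => MvPolynomial.monomial (e i) (1 : R)) '' t =
      (fun s => MvPolynomial.monomial s (1 : R)) '' (e '' t) := by rw [Set.image_image]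
  rw [himage, mem_ideal_span_monomial_image] at hf ⊢
  intro s hs
  obtain ⟨_, ⟨i, hi, rfl⟩, hle⟩ := hf (s + e a) (by
    rwa [mem_support_iff, coeff_mul_monomial, mul_one, ← mem_support_iff])
  refine ⟨e i, ⟨i, hi, rfl⟩, fun v => ?_⟩
  by_cases hv : v ∈ (e i).support
  · have hva : v ∉ (e a).support :=
      Finset.disjoint_left.mp (he (ne_of_mem_of_not_mem hi ha)) hv
    simpa [Finsupp.notMem_support_iff.mp hva] using hle v
  · rw [Finsupp.notMem_support_iff.mp hv]
    exact Nat.zero_le _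

end HasKoszulSyzygies

end Koszul

section WeightFiltration

variable {σ R : Type*} {w : σ → ℕ} {k n : ℕ}

/-- The polynomials all of whose monomials have `w`-weight less than `n`. The strict inequality
lets the smallest step of the filtration be zero. -/
def weightLT (R : Type*) [CommSemiring R] (w : σ → ℕ) (n : ℕ) : Submodule R (MvPolynomial σ R) :=
  restrictSupport R {s | Finsupp.weight w s < n}

section Semiring

variable [CommSemiring R] {p q : MvPolynomial σ R}

theorem weightLT_mono : Monotone (weightLT R w) :=
  fun _ _ h => restrictSupport_mono R fun _ hs => lt_of_lt_of_le hs h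

theorem eq_zero_of_mem_weightLT_zero (hp : p ∈ weightLT R w 0) : p = 0 := by
  rw [← support_eq_empty, Finset.eq_empty_iff_forall_notMem]
  exact fun s hs => Nat.not_lt_zero _ (hp hs)

theorem mem_weightLT_of_isWeightedHomogeneous (hp : IsWeightedHomogeneous w p k) (h : k < n) :
    p ∈ weightLT R w n :=
  fun _ hs => (hp (mem_support_iff.mp hs)).trans_lt h

theorem mem_weightLT_weightedTotalDegree (w : σ → ℕ) (p : MvPolynomial σ R) :
    p ∈ weightLT R w (weightedTotalDegree w p + 1) :=
  fun _ hs => Nat.lt_succ_of_le (le_weightedTotalDegree w hs)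

theorem weightedHomogeneousComponent_eq_zero_of_mem_weightLT (hp : p ∈ weightLT R w k)
    (h : k ≤ n) : weightedHomogeneousComponent w n p = 0 :=
  weightedHomogeneousComponent_eq_zero' _ _ fun _ hs => ((hp hs).trans_le h).ne

theorem mul_mem_weightLT (hp : p ∈ weightLT R w k) (hq : q ∈ weightLT R w (n + 1)) :
    p * q ∈ weightLT R w (k + n) := by
  classical
  intro s hs
  obtain ⟨a, ha, b, hb, rfl⟩ := Finset.mem_add.mp (support_mul p q hs)
  have hak : Finsupp.weight w a < k := hp ha
  have hbn : Finsupp.weight w b < n + 1 := hq hb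
  rw [Set.mem_ofPred_eq, map_add]
  omega

theorem pderiv_mem_weightLT (v : σ) (hp : p ∈ weightLT R w n) : pderiv v p ∈ weightLT R w n := by
  intro s hs
  have hsp : s + Finsupp.single v 1 ∈ p.support := by
    rw [mem_support_iff]
    exact left_ne_zero_of_mul (coeff_pderiv p s ▸ mem_support_iff.mp hs)
  have hlt : Finsupp.weight w (s + Finsupp.single v 1) < n := hp hsp
  rw [map_add] at hlt
  exact (Nat.le_add_right _ _).trans_lt hlt

theorem weightLT_le_of_monotone {M : ℕ → Submodule R (MvPolynomial σ R)} (hM : Monotone M)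
    (hC : ∀ c, C c ∈ M 0)
    (hX : ∀ k v p, IsWeightedHomogeneous w p k → p ∈ M k → p * X v ∈ M (k + w v)) (k : ℕ) :
    weightLT R w (k + 1) ≤ M k := by
  classical
  intro p hp
  rw [p.as_sum]
  refine sum_mem fun s hs => ?_
  obtain ⟨l, hl, hMl⟩ : ∃ l, IsWeightedHomogeneous w (monomial s (coeff s p)) l ∧
      monomial s (coeff s p) ∈ M l :=
    induction_on_monomial (fun c => ⟨0, isWeightedHomogeneous_C w c, hC c⟩)
      (fun p v ⟨l, hl, hMl⟩ =>
        ⟨l + w v, hl.mul (isWeightedHomogeneous_X R w v), hX l v p hl hMl⟩) s _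
  obtain rfl : Finsupp.weight w s = l :=
    hl (by rwa [coeff_monomial, if_pos rfl, ← mem_support_iff])
  exact hM (Nat.lt_succ_iff.mp (hp hs)) hMl

end Semiring

variable [CommRing R] {p q : MvPolynomial σ R}

theorem sub_weightedHomogeneousComponent_mem_weightLT (hp : p ∈ weightLT R w (k + 1)) :
    p - weightedHomogeneousComponent w k p ∈ weightLT R w k := by
  intro s hs
  replace hs : coeff s (p - weightedHomogeneousComponent w k p) ≠ 0 := mem_support_iff.mp hs
  rw [coeff_sub, coeff_weightedHomogeneousComponent] at hs
  split_ifs at hs with h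
  · exact absurd (sub_self _) hs
  · rw [sub_zero, ← mem_support_iff] at hs
    exact (Nat.lt_succ_iff.mp (hp hs)).lt_of_ne h

attribute [local instance] MvPolynomial.weightedGradedAlgebra

theorem weightedHomogeneousComponent_mul_of_isWeightedHomogeneous (p : MvPolynomial σ R)
    (hq : IsWeightedHomogeneous w q n) (k : ℕ) :
    weightedHomogeneousComponent w (k + n) (p * q) = weightedHomogeneousComponent w k p * q := by
  have := DirectSum.coe_decompose_mul_add_of_right_mem (weightedHomogeneousSubmodule R w)
    (i := k) (a := p) hq
  simpa only [← weightedDecomposition.decompose'_apply] using! this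

theorem weightedHomogeneousComponent_mul_of_isWeightedHomogeneous_of_lt (p : MvPolynomial σ R)
    (hq : IsWeightedHomogeneous w q n) (h : k < n) :
    weightedHomogeneousComponent w k (p * q) = 0 := by
  have := DirectSum.coe_decompose_mul_of_right_mem_of_not_le (weightedHomogeneousSubmodule R w)
    (n := k) (a := p) hq h.not_ge
  simpa only [← weightedDecomposition.decompose'_apply] using! this

namespace HasKoszulSyzygies

variable {ι : Type*} {s : Finset ι} {r f : ι → MvPolynomial σ R} {d : ℕ}

theorem eq_zero_of_lt (h : HasKoszulSyzygies s r) (hr : ∀ i, IsWeightedHomogeneous w (r i) d)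
    (hf : ∀ i, IsWeightedHomogeneous w (f i) n) (hsum : ∑ i ∈ s, f i * r i = 0) (hnd : n < d) :
    ∀ i ∈ s, f i = 0 := by
  obtain ⟨u, -, hfu⟩ := h f hsum
  intro i hi
  rw [← (hf i).weightedHomogeneousComponent_same, hfu i hi, map_sum]
  exact Finset.sum_eq_zero fun j _ =>
    weightedHomogeneousComponent_mul_of_isWeightedHomogeneous_of_lt (u i j) (hr j) hnd

theorem exists_isWeightedHomogeneous (h : HasKoszulSyzygies s r)
    (hr : ∀ i, IsWeightedHomogeneous w (r i) d)
    (hf : ∀ i, IsWeightedHomogeneous w (f i) (k + d)) (hsum : ∑ i ∈ s, f i * r i = 0) :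
    ∃ u, IsAlternating u ∧ (∀ i j, IsWeightedHomogeneous w (u i j) k) ∧
      ∀ i ∈ s, f i = ∑ j ∈ s, u i j * r j := by
  obtain ⟨u, hu, hfu⟩ := h f hsum
  refine ⟨fun i j => weightedHomogeneousComponent w k (u i j), hu.map _,
    fun i j => weightedHomogeneousComponent_isWeightedHomogeneous _ _, fun i hi => ?_⟩
  rw [← (hf i).weightedHomogeneousComponent_same, hfu i hi, map_sum]
  exact Finset.sum_congr rfl fun j _ =>
    weightedHomogeneousComponent_mul_of_isWeightedHomogeneous (u i j) (hr j) k

end HasKoszulSyzygies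

end WeightFiltration

section SymbolCalculus

variable {σ R A : Type*} [CommRing R] (w : σ → ℕ) {k n : ℕ}

section Module

variable [AddCommGroup A] [Module R A] (T : MvPolynomial σ R ≃ₗ[R] A)

/-- The elements of order less than `n`, where the order of `T p` is the `w`-weighted degree
of `p`. -/
def orderLT (n : ℕ) : Submodule R A := (weightLT R w n).comap T.symm.toLinearMap

/-- `P` has order at most `k` and its part of order `k` is `p`, which may be zero. -/
structure HasSymbol (k : ℕ) (P : A) (p : MvPolynomial σ R) : Prop where
  isWeightedHomogeneous : IsWeightedHomogeneous w p k
  sub_apply_mem : P - T p ∈ orderLT w T k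

variable {w T} {P Q : A} {p q : MvPolynomial σ R}

theorem orderLT_mono : Monotone (orderLT w T) :=
  fun _ _ h => Submodule.comap_mono (weightLT_mono h)

theorem apply_mem_orderLT_iff : T p ∈ orderLT w T n ↔ p ∈ weightLT R w n := by
  rw [orderLT, Submodule.mem_comap, LinearEquiv.coe_coe, LinearEquiv.symm_apply_apply]

theorem eq_zero_of_mem_orderLT_zero (hP : P ∈ orderLT w T 0) : P = 0 :=
  T.symm.map_eq_zero_iff.mp (eq_zero_of_mem_weightLT_zero hP)

theorem exists_forall_mem_orderLT {ι : Type*} [Finite ι] (Q : ι → A) :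
    ∃ n, ∀ i, Q i ∈ orderLT w T n := by
  obtain ⟨n, hn⟩ :=
    (Set.finite_range fun i => weightedTotalDegree w (T.symm (Q i)) + 1).bddAbove
  exact ⟨n, fun i => orderLT_mono (hn ⟨i, rfl⟩) (mem_weightLT_weightedTotalDegree w _)⟩

theorem hasSymbol_weightedHomogeneousComponent (hP : P ∈ orderLT w T (k + 1)) :
    HasSymbol w T k P (weightedHomogeneousComponent w k (T.symm P)) where
  isWeightedHomogeneous := weightedHomogeneousComponent_isWeightedHomogeneous _ _
  sub_apply_mem := by
    rw [orderLT, Submodule.mem_comap, map_sub, LinearEquiv.coe_coe, T.symm_apply_apply]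
    exact sub_weightedHomogeneousComponent_mem_weightLT hP

theorem hasSymbol_apply (hp : IsWeightedHomogeneous w p k) : HasSymbol w T k (T p) p :=
  ⟨hp, by rw [sub_self]; exact zero_mem _⟩

namespace HasSymbol

theorem mem_orderLT (h : HasSymbol w T k P p) : P ∈ orderLT w T (k + 1) := by
  rw [← sub_add_cancel P (T p)]
  exact add_mem (orderLT_mono k.le_succ h.sub_apply_mem) (apply_mem_orderLT_iff.mpr
    (mem_weightLT_of_isWeightedHomogeneous h.isWeightedHomogeneous k.lt_succ_self))

theorem sub (hP : HasSymbol w T k P p) (hQ : HasSymbol w T k Q q) :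
    HasSymbol w T k (P - Q) (p - q) where
  isWeightedHomogeneous := hP.isWeightedHomogeneous.sub hQ.isWeightedHomogeneous
  sub_apply_mem := by
    rw [map_sub, sub_sub_sub_comm]
    exact sub_mem hP.sub_apply_mem hQ.sub_apply_mem

theorem sum {ι : Type*} {s : Finset ι} {P : ι → A} {p : ι → MvPolynomial σ R}
    (h : ∀ i ∈ s, HasSymbol w T k (P i) (p i)) :
    HasSymbol w T k (∑ i ∈ s, P i) (∑ i ∈ s, p i) where
  isWeightedHomogeneous := .sum _ _ _ fun i hi => (h i hi).isWeightedHomogeneous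
  sub_apply_mem := by
    rw [map_sum, ← Finset.sum_sub_distrib]
    exact sum_mem fun i hi => (h i hi).sub_apply_mem

theorem add_of_mem_orderLT (hP : HasSymbol w T k P p) (hQ : Q ∈ orderLT w T k) :
    HasSymbol w T k (P + Q) p where
  isWeightedHomogeneous := hP.isWeightedHomogeneous
  sub_apply_mem := by
    rw [add_sub_right_comm]
    exact add_mem hP.sub_apply_mem hQ

theorem sub_of_mem_orderLT (hP : HasSymbol w T k P p) (hQ : Q ∈ orderLT w T k) :
    HasSymbol w T k (P - Q) p := by
  rw [sub_eq_add_neg]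
  exact hP.add_of_mem_orderLT (neg_mem hQ)

theorem eq_zero_of_mem_orderLT (h : HasSymbol w T k P p) (hP : P ∈ orderLT w T n)
    (hnk : n ≤ k) : p = 0 := by
  have hTp : T p ∈ orderLT w T k := by
    rw [← sub_sub_cancel P (T p)]
    exact sub_mem (orderLT_mono hnk hP) h.sub_apply_mem
  rw [← h.isWeightedHomogeneous.weightedHomogeneousComponent_same]
  exact weightedHomogeneousComponent_eq_zero_of_mem_weightLT
    (apply_mem_orderLT_iff.mp hTp) le_rfl

theorem mem_orderLT_of_eq_zero (h : HasSymbol w T k P 0) : P ∈ orderLT w T k := by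
  simpa only [map_zero, sub_zero] using h.sub_apply_mem

theorem unique (hp : HasSymbol w T k P p) (hq : HasSymbol w T k P q) : p = q :=
  sub_eq_zero.mp <| (hp.sub hq).eq_zero_of_mem_orderLT (by rw [sub_self]; exact zero_mem _) le_rfl

end HasSymbol

end Module

section Ring

variable [Ring A] [Module R A] {T : MvPolynomial σ R ≃ₗ[R] A} {P Q : A} {p q : MvPolynomial σ R}

/-- The linear isomorphism `T` is multiplicative up to terms of lower order, so that the graded
ring associated with the order filtration of `A` is the polynomial ring. -/
def IsQuantization (T : MvPolynomial σ R ≃ₗ[R] A) : Prop :=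
  ∀ ⦃k n : ℕ⦄ ⦃p q : MvPolynomial σ R⦄, p ∈ weightLT R w (k + 1) → q ∈ weightLT R w (n + 1) →
    T p * T q - T (p * q) ∈ orderLT w T (k + n)

theorem isQuantization_refl : IsQuantization w (LinearEquiv.refl R (MvPolynomial σ R)) :=
  fun _ _ _ _ _ _ => by simp only [LinearEquiv.refl_apply, sub_self, zero_mem]

variable {w}

theorem HasSymbol.mul (hT : IsQuantization w T) (hP : HasSymbol w T k P p)
    (hQ : HasSymbol w T n Q q) : HasSymbol w T (k + n) (P * Q) (p * q) where
  isWeightedHomogeneous := hP.isWeightedHomogeneous.mul hQ.isWeightedHomogeneous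
  sub_apply_mem := by
    obtain ⟨p', rfl⟩ := T.surjective P
    obtain ⟨q', rfl⟩ := T.surjective Q
    have hp' : p' - p ∈ weightLT R w k := by
      simpa only [← map_sub, apply_mem_orderLT_iff] using hP.sub_apply_mem
    have hq' : q' - q ∈ weightLT R w n := by
      simpa only [← map_sub, apply_mem_orderLT_iff] using hQ.sub_apply_mem
    have hlower : p' * q' - p * q ∈ weightLT R w (k + n) := by
      rw [show p' * q' - p * q = (p' - p) * q' + (q' - q) * p by ring]
      refine add_mem (mul_mem_weightLT hp' (apply_mem_orderLT_iff.mp hQ.mem_orderLT)) ?_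
      rw [add_comm k]
      exact mul_mem_weightLT hq'
        (mem_weightLT_of_isWeightedHomogeneous hP.isWeightedHomogeneous k.lt_succ_self)
    rw [← sub_add_sub_cancel _ (T (p' * q')), ← map_sub]
    exact add_mem (hT (apply_mem_orderLT_iff.mp hP.mem_orderLT)
      (apply_mem_orderLT_iff.mp hQ.mem_orderLT)) (apply_mem_orderLT_iff.mpr hlower)

variable {ι : Type*} [Fintype ι] {r : ι → MvPolynomial σ R} {d : ℕ} {P G : ι → A}

theorem exists_isAlternating_sub_mem_orderLT_of_succ (hT : IsQuantization w T)
    (hr : HasKoszulSyzygies Finset.univ r) (hP : ∀ i, HasSymbol w T d (P i) (r i))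
    (hG : ∀ i, HasSymbol w T d (G i) (r i)) {Q : ι → A} (hQ : ∀ i, Q i ∈ orderLT w T (n + 1))
    (hsum : ∑ i, Q i * P i ∈ orderLT w T (n + d)) :
    ∃ U, IsAlternating U ∧ ∀ i, Q i - ∑ j, U i j * G j ∈ orderLT w T n := by
  have hr_homogeneous := fun i => (hP i).isWeightedHomogeneous
  choose q hq using fun i => (⟨_, hasSymbol_weightedHomogeneousComponent (hQ i)⟩ :
    ∃ q, HasSymbol w T n (Q i) q)
  have hq_homogeneous := fun i => (hq i).isWeightedHomogeneous
  have hqr : ∑ i, q i * r i = 0 :=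
    (HasSymbol.sum fun i _ => (hq i).mul hT (hP i)).eq_zero_of_mem_orderLT hsum le_rfl
  rcases lt_or_ge n d with hnd | hdn
  · have hq_zero := hr.eq_zero_of_lt hr_homogeneous hq_homogeneous hqr hnd
    refine ⟨0, .zero, fun i => ?_⟩
    simpa using (hq_zero i (Finset.mem_univ i) ▸ hq i).mem_orderLT_of_eq_zero
  · obtain ⟨l, rfl⟩ := Nat.exists_eq_add_of_le' hdn
    obtain ⟨u, hu, hu_homogeneous, hqu⟩ :=
      hr.exists_isWeightedHomogeneous hr_homogeneous hq_homogeneous hqr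
    refine ⟨fun i j => T (u i j), hu.map T, fun i => HasSymbol.mem_orderLT_of_eq_zero ?_⟩
    rw [← sub_eq_zero.mpr (hqu i (Finset.mem_univ i))]
    exact (hq i).sub (.sum fun j _ => (hasSymbol_apply (hu_homogeneous i j)).mul hT (hG j))

/-- The relations `G j * P i - G i * P j = 0` lift the Koszul syzygies of the symbols `r`, so
subtracting them cancels the leading terms of the coefficients as long as these cancel in the
sum. -/
theorem exists_isAlternating_sub_mem_orderLT (hT : IsQuantization w T)
    (hr : HasKoszulSyzygies Finset.univ r) (hP : ∀ i, HasSymbol w T d (P i) (r i))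
    (hG : ∀ i, HasSymbol w T d (G i) (r i)) (hGP : ∀ i j, G j * P i = G i * P j) (Q : ι → A)
    (hsum : ∑ i, Q i * P i ∈ orderLT w T (n + d)) :
    ∃ U, IsAlternating U ∧ ∀ i, Q i - ∑ j, U i j * G j ∈ orderLT w T n := by
  obtain ⟨N, hN⟩ := exists_forall_mem_orderLT (w := w) (T := T) Q
  replace hN i : Q i ∈ orderLT w T (n + N) := orderLT_mono (Nat.le_add_left N n) (hN i)
  induction N generalizing Q with
  | zero => exact ⟨0, .zero, by simpa using hN⟩
  | succ N ih =>
    obtain ⟨U, hU, hQU⟩ := exists_isAlternating_sub_mem_orderLT_of_succ hT hr hP hG hN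
      (orderLT_mono (by simp) hsum)
    obtain ⟨V, hV, hQV⟩ := ih _ (by rwa [hU.sum_sub_sum_mul_mul hGP]) hQU
    refine ⟨U + V, hU.add hV, fun i => ?_⟩
    simpa only [Pi.add_apply, add_mul, Finset.sum_add_distrib, sub_sub] using hQV i

theorem HasSymbol.mem_span_range_of_sum_mul (hT : IsQuantization w T)
    (hr : HasKoszulSyzygies Finset.univ r) (hP : ∀ i, HasSymbol w T d (P i) (r i))
    (hG : ∀ i, HasSymbol w T d (G i) (r i)) (hGP : ∀ i j, G j * P i = G i * P j) {Q : ι → A}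
    (hp : HasSymbol w T k (∑ i, Q i * P i) p) : p ∈ Ideal.span (Set.range r) := by
  rcases lt_or_ge k d with hkd | hdk
  · obtain ⟨U, hU, hQU⟩ := exists_isAlternating_sub_mem_orderLT (n := 0) hT hr hP hG hGP Q
      (orderLT_mono (by omega) hp.mem_orderLT)
    have hsum : ∑ i, Q i * P i = 0 := by
      rw [← hU.sum_sub_sum_mul_mul hGP]
      exact Finset.sum_eq_zero fun i _ => by rw [eq_zero_of_mem_orderLT_zero (hQU i), zero_mul]
    rw [hsum] at hp
    rw [hp.eq_zero_of_mem_orderLT (zero_mem _) le_rfl]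
    exact zero_mem _
  · obtain ⟨n, rfl⟩ := Nat.exists_eq_add_of_le' hdk
    obtain ⟨U, hU, hQU⟩ := exists_isAlternating_sub_mem_orderLT (n := n + 1) hT hr hP hG hGP Q
      (orderLT_mono (by omega) hp.mem_orderLT)
    rw [← hU.sum_sub_sum_mul_mul hGP] at hp
    rw [hp.unique (.sum fun i _ =>
      (hasSymbol_weightedHomogeneousComponent (hQU i)).mul hT (hP i))]
    exact sum_mem fun i _ => Ideal.mul_mem_left _ _ (Ideal.subset_span ⟨i, rfl⟩)

theorem HasKoszulSyzygies.of_leadingForm {f : ι → MvPolynomial σ R}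
    (hr : HasKoszulSyzygies Finset.univ r) (hr_homogeneous : ∀ i, IsWeightedHomogeneous w (r i) d)
    (hfr : ∀ i, f i - r i ∈ weightLT R w d) : HasKoszulSyzygies Finset.univ f := by
  intro q hq
  have hf i : HasSymbol w (LinearEquiv.refl R _) d (f i) (r i) := ⟨hr_homogeneous i, hfr i⟩
  obtain ⟨u, hu, hqu⟩ := exists_isAlternating_sub_mem_orderLT (n := 0) (isQuantization_refl w)
    hr hf hf (fun i j => mul_comm _ _) q (by rw [hq]; exact zero_mem _)
  exact ⟨u, hu, fun i _ => sub_eq_zero.mp (eq_zero_of_mem_orderLT_zero (hqu i))⟩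

end Ring

end SymbolCalculus

/-- The algebraic structure of `Subalgebra.toRing` with the semiring structure of
`Subalgebra.toSemiring` as a literal field, so that the two unify without unfolding
`weylAlgebra`. -/
local instance (m : ℕ) : Ring (D m) :=
  { (inferInstance : Semiring (D m)), (inferInstance : Ring (D m)) with }

section WeylAlgebra

variable {m : ℕ} {i j : Fin m}

theorem d_mul_x_self (i : Fin m) : d i * x i = x i * d i + 1 := by
  apply Subtype.ext
  change derivOp m i * mulOp m (X i) = mulOp m (X i) * derivOp m i + 1
  refine LinearMap.ext fun p => ?_
  simp only [Module.End.mul_apply, LinearMap.add_apply, Module.End.one_apply, mulOp_apply,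
    derivOp_apply, pderiv_mul, pderiv_X_self, one_mul, add_comm]

theorem d_commute_x_of_ne (h : i ≠ j) : Commute (d i) (x j) := by
  apply Subtype.ext
  change derivOp m i * mulOp m (X j) = mulOp m (X j) * derivOp m i
  refine LinearMap.ext fun p => ?_
  simp only [Module.End.mul_apply, mulOp_apply, derivOp_apply, pderiv_mul, pderiv_X_of_ne h.symm,
    zero_mul, zero_add]

theorem x_mul_normalOrder (i : Fin m) (p : SymbolRing m) :
    x i * normalOrder m p = normalOrder m (X (Sum.inl i) * p) := by
  induction p using MvPolynomial.induction_on' with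
  | monomial s c =>
    obtain ⟨α, β, rfl⟩ := exists_joinExp s
    have hexp : Finsupp.single (Sum.inl i) 1 + joinExp α β =
        joinExp (α + Finsupp.single i 1) β := by
      ext (j | j) <;> simp [joinExp, Finsupp.single_apply, add_comm]
    rw [X, monomial_mul, normalOrder_monomial, normalOrder_monomial, hexp, normalMonomial_joinExp,
      normalMonomial_joinExp, mul_smul_comm, ← mul_assoc, x_mul_xPow, one_mul]
  | add p q hp hq => rw [map_add, mul_add, hp, hq, mul_add, map_add]

theorem d_mul_normalOrder (i : Fin m) (p : SymbolRing m) :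
    d i * normalOrder m p = normalOrder m (X (Sum.inr i) * p + pderiv (Sum.inl i) p) := by
  induction p using MvPolynomial.induction_on' with
  | monomial s c =>
    obtain ⟨α, β, rfl⟩ := exists_joinExp s
    have hadd : Finsupp.single (Sum.inr i) 1 + joinExp α β =
        joinExp α (β + Finsupp.single i 1) := by
      ext (j | j) <;> simp [joinExp, Finsupp.single_apply, add_comm]
    have hsub : joinExp α β - Finsupp.single (Sum.inl i) 1 =
        joinExp (α - Finsupp.single i 1) β := by
      ext (j | j) <;> simp [joinExp, Finsupp.single_apply]
    rw [map_add, pderiv_monomial, X, monomial_mul, normalOrder_monomial, normalOrder_monomial,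
      normalOrder_monomial, hadd, hsub, normalMonomial_joinExp, normalMonomial_joinExp,
      normalMonomial_joinExp, mul_smul_comm, ← mul_assoc, d_mul_xPow, add_mul, mul_assoc,
      d_mul_dPow, smul_mul_assoc, smul_add, smul_smul, one_mul]
    rfl
  | add p q hp hq =>
    rw [map_add, mul_add, hp, hq, ← map_add, map_add (pderiv _), mul_add, add_add_add_comm]

theorem normalOrder_mul_d (i : Fin m) (p : SymbolRing m) :
    normalOrder m p * d i = normalOrder m (p * X (Sum.inr i)) := by
  induction p using MvPolynomial.induction_on' with
  | monomial s c =>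
    obtain ⟨α, β, rfl⟩ := exists_joinExp s
    have hexp : joinExp α β + Finsupp.single (Sum.inr i) 1 =
        joinExp α (β + Finsupp.single i 1) := by
      ext (j | j) <;> simp [joinExp, Finsupp.single_apply]
    have hcomm : dPow β * d i = d i * dPow β :=
      (Finset.noncommProd_commute _ _ _ _ fun j _ => (d_commute i j).pow_right _).symm
    rw [X, monomial_mul, normalOrder_monomial, normalOrder_monomial, hexp, normalMonomial_joinExp,
      normalMonomial_joinExp, smul_mul_assoc, mul_assoc, hcomm, d_mul_dPow, mul_one]
  | add p q hp hq => rw [map_add, add_mul, hp, hq, add_mul, map_add]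

theorem normalMonomial_zero : normalMonomial (0 : Fin m ⊕ Fin m →₀ ℕ) = 1 := by
  have hx : xPow (0 : Fin m → ℕ) = 1 :=
    (Finset.noncommProd_eq_pow_card _ _ _ 1 fun _ _ => pow_zero _).trans (one_pow _)
  have hd : dPow (0 : Fin m → ℕ) = 1 :=
    (Finset.noncommProd_eq_pow_card _ _ _ 1 fun _ _ => pow_zero _).trans (one_pow _)
  exact (congrArg₂ (· * ·) hx hd).trans (one_mul 1)

theorem normalOrder_C (c : ℂ) : normalOrder m (C c) = algebraMap ℂ (D m) c := by
  rw [C_apply, normalOrder_monomial, normalMonomial_zero, Algebra.algebraMap_eq_smul_one]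

theorem normalOrder_X_inl (i : Fin m) : normalOrder m (X (Sum.inl i)) = x i := by
  rw [← mul_one (X _), ← x_mul_normalOrder, ← C_1, normalOrder_C, map_one, mul_one]

/-- Normal ordering as a linear isomorphism; its inverse is the total symbol. -/
def normalOrderEquiv (m : ℕ) : SymbolRing m ≃ₗ[ℂ] D m :=
  LinearEquiv.ofBijective (normalOrder m) (normalOrder_bijective m)

theorem normalOrderEquiv_apply (p : SymbolRing m) : normalOrderEquiv m p = normalOrder m p := rfl

theorem x_mul_mem_orderLT {n : ℕ} (i : Fin m) {P : D m}
    (hP : P ∈ orderLT (weight01 m) (normalOrderEquiv m) n) :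
    x i * P ∈ orderLT (weight01 m) (normalOrderEquiv m) n := by
  obtain ⟨p, rfl⟩ := (normalOrderEquiv m).surjective P
  rw [normalOrderEquiv_apply, x_mul_normalOrder, ← normalOrderEquiv_apply, apply_mem_orderLT_iff,
    mul_comm]
  exact mul_mem_weightLT (n := 0) (apply_mem_orderLT_iff.mp hP)
    (mem_weightLT_of_isWeightedHomogeneous (isWeightedHomogeneous_X _ _ _) Nat.zero_lt_one)

/-- The failure of normal ordering to be multiplicative, as a bilinear map. -/
def mulDefect (m : ℕ) : SymbolRing m →ₗ[ℂ] SymbolRing m →ₗ[ℂ] D m :=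
  (LinearMap.mul ℂ (D m)).compl₁₂ (normalOrder m) (normalOrder m) -
    (LinearMap.mul ℂ (SymbolRing m)).compr₂ (normalOrder m)

theorem mulDefect_apply (p q : SymbolRing m) :
    mulDefect m p q = normalOrder m p * normalOrder m q - normalOrder m (p * q) := rfl

theorem mulDefect_C (c : ℂ) (q : SymbolRing m) : mulDefect m (C c) q = 0 := by
  rw [mulDefect_apply, normalOrder_C, ← Algebra.smul_def, C_mul', map_smul, sub_self]

theorem mulDefect_mul_X_inl (p q : SymbolRing m) (i : Fin m) :
    mulDefect m (p * X (Sum.inl i)) q = x i * mulDefect m p q := by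
  rw [mulDefect_apply, mulDefect_apply, mul_comm p, ← x_mul_normalOrder, mul_assoc (X _),
    ← x_mul_normalOrder, mul_assoc (x i), mul_sub]

theorem mulDefect_mul_X_inr (p q : SymbolRing m) (i : Fin m) :
    mulDefect m (p * X (Sum.inr i)) q =
      mulDefect m p (X (Sum.inr i) * q + pderiv (Sum.inl i) q) +
        normalOrder m (p * pderiv (Sum.inl i) q) := by
  rw [mulDefect_apply, mulDefect_apply, ← normalOrder_mul_d, mul_assoc, d_mul_normalOrder,
    mul_add p, map_add _ (p * _), ← mul_assoc p, sub_add_eq_sub_sub, sub_add_cancel]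

theorem isQuantization_normalOrderEquiv (m : ℕ) :
    IsQuantization (weight01 m) (normalOrderEquiv m) := by
  let M (k : ℕ) : Submodule ℂ (SymbolRing m) :=
    ⨅ (n : ℕ) (q ∈ weightLT ℂ (weight01 m) (n + 1)),
      (orderLT (weight01 m) (normalOrderEquiv m) (k + n)).comap ((mulDefect m).flip q)
  have mem_M {k p} : p ∈ M k ↔ ∀ n, ∀ q ∈ weightLT ℂ (weight01 m) (n + 1),
      mulDefect m p q ∈ orderLT (weight01 m) (normalOrderEquiv m) (k + n) := by
    simp only [M, Submodule.mem_iInf, Submodule.mem_comap, LinearMap.flip_apply]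
  suffices hM : ∀ k, weightLT ℂ (weight01 m) (k + 1) ≤ M k from
    fun k n p q hp hq => mem_M.mp (hM k hp) n q hq
  refine weightLT_le_of_monotone (fun k l hkl p hp => ?_) (fun c => ?_) ?_
  · exact mem_M.mpr fun n q hq => orderLT_mono (Nat.add_le_add_right hkl n) (mem_M.mp hp n q hq)
  · exact mem_M.mpr fun n q _ => by rw [mulDefect_C]; exact zero_mem _
  rintro k (i | i) p hp_homogeneous hp <;> refine mem_M.mpr fun n q hq => ?_
  · rw [mulDefect_mul_X_inl]
    exact x_mul_mem_orderLT i (mem_M.mp hp n q hq)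
  · have hderiv := pderiv_mem_weightLT (Sum.inl i) hq
    have hd : X (Sum.inr i) * q + pderiv (Sum.inl i) q ∈ weightLT ℂ (weight01 m) (n + 1 + 1) := by
      refine add_mem ?_ (weightLT_mono (Nat.le_succ _) hderiv)
      rw [mul_comm]
      exact mul_mem_weightLT hq (mem_weightLT_of_isWeightedHomogeneous
        (isWeightedHomogeneous_X ℂ (weight01 m) (Sum.inr i)) Nat.one_lt_two)
    rw [mulDefect_mul_X_inr, weight01, Sum.elim_inr, add_assoc, add_comm 1 n]
    refine add_mem (mem_M.mp hp (n + 1) _ hd) (apply_mem_orderLT_iff.mpr ?_)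
    rw [add_comm n 1, ← add_assoc]
    exact mul_mem_weightLT
      (mem_weightLT_of_isWeightedHomogeneous hp_homogeneous k.lt_succ_self) hderiv

theorem hasSymbol_initialForm (P : D m) :
    HasSymbol (weight01 m) (normalOrderEquiv m)
      (weightedTotalDegree (weight01 m) (totalSymbol P)) P (initialForm P) :=
  hasSymbol_weightedHomogeneousComponent (mem_weightLT_weightedTotalDegree _ _)

theorem HasSymbol.initialForm_eq {k : ℕ} {P : D m} {p : SymbolRing m}
    (h : HasSymbol (weight01 m) (normalOrderEquiv m) k P p) (hp : p ≠ 0) : initialForm P = p := by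
  have hdegree : weightedTotalDegree (weight01 m) (totalSymbol P) = k := by
    refine le_antisymm (Finset.sup_le fun s hs => Nat.lt_succ_iff.mp (h.mem_orderLT hs)) ?_
    by_contra! hlt
    exact hp (h.eq_zero_of_mem_orderLT (hasSymbol_initialForm P).mem_orderLT hlt)
  exact (hdegree ▸ hasSymbol_initialForm P).unique h

theorem hasSymbol_x (i : Fin m) :
    HasSymbol (weight01 m) (normalOrderEquiv m) 0 (x i) (X (Sum.inl i)) := by
  rw [← normalOrder_X_inl]
  exact hasSymbol_apply (isWeightedHomogeneous_X _ _ _)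

theorem hasSymbol_d (i : Fin m) :
    HasSymbol (weight01 m) (normalOrderEquiv m) 1 (d i) (X (Sum.inr i)) := by
  have hd : normalOrderEquiv m (X (Sum.inr i)) = d i := by
    rw [normalOrderEquiv_apply, ← one_mul (X _), ← normalOrder_mul_d, ← C_1, normalOrder_C,
      map_one, one_mul]
  rw [← hd]
  exact hasSymbol_apply (isWeightedHomogeneous_X _ _ _)

theorem hasSymbol_euler (i : Fin m) :
    HasSymbol (weight01 m) (normalOrderEquiv m) 1 (euler i) (X (Sum.inl i) * X (Sum.inr i)) :=
  (hasSymbol_x i).mul (isQuantization_normalOrderEquiv m) (hasSymbol_d i)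

theorem algebraMap_mem_orderLT (c : ℂ) :
    algebraMap ℂ (D m) c ∈ orderLT (weight01 m) (normalOrderEquiv m) 1 := by
  rw [← normalOrder_C]
  exact (hasSymbol_apply (isWeightedHomogeneous_C _ c)).mem_orderLT

end WeylAlgebra

section Lauricella

variable {m : ℕ} {i j : Fin m}

theorem LB_eq_mul_sum_sub (i : Fin m) : LB i =
    X (Sum.inl i) * X (Sum.inr i) * ∑ j, X (Sum.inl j) * X (Sum.inr j) -
      X (Sum.inl i) ^ 3 * X (Sum.inr i) ^ 2 := by
  rw [LB, ← Finset.add_sum_erase _ _ (Finset.mem_univ i)]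
  ring

theorem LB_ne_zero (i : Fin m) : LB i ≠ 0 := by
  intro h
  have heval := congrArg (eval (Sum.elim (Pi.single i 2) fun _ => 1)) h
  rw [LB_eq_mul_sum_sub] at heval
  norm_num [Finset.sum_pi_single] at heval

theorem hasKoszulSyzygies_LB (m : ℕ) :
    HasKoszulSyzygies Finset.univ (LB : Fin m → SymbolRing m) := by
  let e (i : Fin m) : Fin m ⊕ Fin m →₀ ℕ := .single (Sum.inl i) 3 + .single (Sum.inr i) 2
  have hX (v : Fin m ⊕ Fin m) : IsWeightedHomogeneous (fun _ => 1) (X v : SymbolRing m) 1 :=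
    isWeightedHomogeneous_X _ _ _
  have he : Pairwise fun i j => Disjoint (e i).support (e j).support := by
    have hsupp (k : Fin m) : (e k).support ⊆ {Sum.inl k, Sum.inr k} :=
      Finsupp.support_add.trans (Finset.union_subset_union Finsupp.support_single_subset
        Finsupp.support_single_subset)
    exact fun i j hij => Finset.disjoint_of_subset_left (hsupp i)
      (Finset.disjoint_of_subset_right (hsupp j) (by simp [hij.symm]))
  have hlead (i : Fin m) : monomial (e i) (1 : ℂ) = X (Sum.inl i) ^ 3 * X (Sum.inr i) ^ 2 := by
    rw [X_pow_eq_monomial, X_pow_eq_monomial, monomial_mul, one_mul]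
  refine (HasKoszulSyzygies.monomial _ he).neg.of_leadingForm (w := fun _ => 1) (d := 5)
    (fun i => ?_) fun i => ?_
  · rw [Pi.neg_apply, hlead]
    exact (((hX _).pow 3).mul ((hX _).pow 2)).neg
  · rw [Pi.neg_apply, hlead, LB_eq_mul_sum_sub, sub_neg_eq_add, sub_add_cancel]
    exact mem_weightLT_of_isWeightedHomogeneous (((hX _).mul (hX _)).mul
      (.sum _ _ 2 fun j _ => (hX (Sum.inl j)).mul (hX (Sum.inr j)))) (Nat.lt_succ_self 4)

theorem x_commute_euler_of_ne (h : i ≠ j) : Commute (x i) (euler j) :=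
  (x_commute i j).mul_right (d_commute_x_of_ne h.symm).symm

theorem x_semiconjBy_euler (i : Fin m) : SemiconjBy (x i) (euler i + 1) (euler i) := by
  change x i * (euler i + 1) = euler i * x i
  rw [euler, mul_assoc, d_mul_x_self]

theorem euler_commute (i j : Fin m) : Commute (euler i) (euler j) := by
  rcases eq_or_ne i j with rfl | h
  · exact Commute.refl _
  · exact (x_commute_euler_of_ne h).mul_left
      ((d_commute_x_of_ne h).mul_right (d_commute i j))

/-- The factor `θ₁ + ⋯ + θ_m + c - 1` of the first term of `ℓ_i^B`. -/
def totalEuler (m : ℕ) (c : ℂ) : D m := ∑ j, euler j + algebraMap ℂ (D m) (c - 1)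

/-- The second term `x_i (θ_i + a_i) (θ_i + b_i)` of `ℓ_i^B`. -/
def shiftTerm (a b : Fin m → ℂ) (i : Fin m) : D m :=
  x i * (euler i + algebraMap ℂ (D m) (a i)) * (euler i + algebraMap ℂ (D m) (b i))

variable (a b : Fin m → ℂ) (c : ℂ)

theorem ellB_eq_euler_mul_sub_shiftTerm (i : Fin m) :
    ellB a b c i = euler i * totalEuler m c - shiftTerm a b i := rfl

theorem euler_commute_totalEuler (i : Fin m) : Commute (euler i) (totalEuler m c) :=
  (Commute.sum_right _ _ _ fun j _ => euler_commute i j).add_right (Algebra.commutes _ _).symm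

theorem x_semiconjBy_totalEuler (i : Fin m) :
    SemiconjBy (x i) (totalEuler m c + 1) (totalEuler m c) := by
  let rest : D m := ∑ j ∈ Finset.univ.erase i, euler j + algebraMap ℂ (D m) (c - 1)
  have hrest : Commute (x i) rest :=
    Commute.add_right (.sum_right _ _ _ fun j hj =>
      x_commute_euler_of_ne (Finset.ne_of_mem_erase hj).symm) (Algebra.commutes _ _).symm
  have htotal : totalEuler m c = euler i + rest := by
    rw [totalEuler, ← Finset.add_sum_erase _ _ (Finset.mem_univ i), add_assoc]
  rw [htotal, add_right_comm]
  exact (x_semiconjBy_euler i).add_right hrest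

theorem commute_shiftTerm {P : D m} (hx : Commute P (x i)) (he : Commute P (euler i)) :
    Commute P (shiftTerm a b i) :=
  (hx.mul_right (he.add_right (Algebra.commutes _ _).symm)).mul_right
    (he.add_right (Algebra.commutes _ _).symm)

theorem shiftTerm_semiconjBy_totalEuler (i : Fin m) :
    SemiconjBy (shiftTerm a b i) (totalEuler m c + 1) (totalEuler m c) := by
  have hshift (z : ℂ) : Commute (euler i + algebraMap ℂ (D m) z) (totalEuler m c + 1) :=
    ((euler_commute_totalEuler c i).add_left (Algebra.commutes _ _)).add_right (.one_right _)
  exact ((x_semiconjBy_totalEuler c i).mul_left (hshift _)).mul_left (hshift _)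

-- The right-hand side is symmetric in `(e, p)` and `(f, q)` when all four commute.
theorem sub_sub_mul_sub_of_semiconjBy {A : Type*} [Ring A] {e f s p q : A} (he : Commute e s)
    (hp : SemiconjBy p (s + 1) s) :
    (f * s - q - f) * (e * s - p) = f * e * (s * s - s) - (f * p + q * e) * s + q * p := by
  have hsp : s * p = p * s + p := by rw [← hp.eq, mul_add, mul_one]
  have hse : f * s * (e * s) = f * e * (s * s) := by
    rw [mul_assoc, ← mul_assoc s, ← he.eq, mul_assoc, mul_assoc]
  simp only [sub_mul, mul_sub, add_mul, hse, mul_assoc f s p, hsp, mul_add, mul_assoc]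
  abel

theorem ellB_sub_euler_mul_ellB (i j : Fin m) :
    (ellB a b c j - euler j) * ellB a b c i = (ellB a b c i - euler i) * ellB a b c j := by
  rcases eq_or_ne i j with rfl | hij
  · rfl
  have hep {k l : Fin m} (h : k ≠ l) : Commute (euler k) (shiftTerm a b l) :=
    commute_shiftTerm a b (x_commute_euler_of_ne h.symm).symm (euler_commute k l)
  have hxp : Commute (x i) (shiftTerm a b j) :=
    commute_shiftTerm a b (x_commute i j) (x_commute_euler_of_ne hij)
  have hpp : Commute (shiftTerm a b i) (shiftTerm a b j) :=
    (commute_shiftTerm a b hxp.symm (hep hij).symm).symm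
  rw [ellB_eq_euler_mul_sub_shiftTerm, ellB_eq_euler_mul_sub_shiftTerm,
    sub_sub_mul_sub_of_semiconjBy (euler_commute_totalEuler c i)
      (shiftTerm_semiconjBy_totalEuler a b c i),
    sub_sub_mul_sub_of_semiconjBy (euler_commute_totalEuler c j)
      (shiftTerm_semiconjBy_totalEuler a b c j),
    (euler_commute j i).eq, (hep hij.symm).eq, (hep hij).eq, hpp.eq,
    add_comm (shiftTerm a b j * euler i)]

theorem HasSymbol.add_algebraMap {P : D m} {p : SymbolRing m}
    (h : HasSymbol (weight01 m) (normalOrderEquiv m) 1 P p) (z : ℂ) :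
    HasSymbol (weight01 m) (normalOrderEquiv m) 1 (P + algebraMap ℂ (D m) z) p :=
  h.add_of_mem_orderLT (algebraMap_mem_orderLT z)

theorem hasSymbol_ellB (i : Fin m) :
    HasSymbol (weight01 m) (normalOrderEquiv m) 2 (ellB a b c i) (LB i) := by
  have hT := isQuantization_normalOrderEquiv m
  have htotal := (HasSymbol.sum (s := .univ) fun j _ => hasSymbol_euler (m := m) j).add_algebraMap
    (c - 1)
  have hLB : LB i = X (Sum.inl i) * X (Sum.inr i) * ∑ j, X (Sum.inl j) * X (Sum.inr j) -
      X (Sum.inl i) * (X (Sum.inl i) * X (Sum.inr i)) * (X (Sum.inl i) * X (Sum.inr i)) := by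
    rw [LB_eq_mul_sum_sub]
    ring
  rw [hLB]
  exact ((hasSymbol_euler i).mul hT htotal).sub (((hasSymbol_x i).mul hT
    ((hasSymbol_euler i).add_algebraMap (a i))).mul hT ((hasSymbol_euler i).add_algebraMap (b i)))

theorem hasSymbol_ellB_sub_euler (i : Fin m) :
    HasSymbol (weight01 m) (normalOrderEquiv m) 2 (ellB a b c i - euler i) (LB i) :=
  (hasSymbol_ellB a b c i).sub_of_mem_orderLT (hasSymbol_euler i).mem_orderLT

theorem initialForm_ellB (i : Fin m) : initialForm (ellB a b c i) = LB i :=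
  (hasSymbol_ellB a b c i).initialForm_eq (LB_ne_zero i)

theorem initialIdeal_idealB :
    initialIdeal (idealB a b c) = Ideal.span (Set.range (LB : Fin m → SymbolRing m)) := by
  refine le_antisymm (Ideal.span_le.mpr ?_) (Ideal.span_le.mpr ?_)
  · rintro _ ⟨P, hP, rfl⟩
    obtain ⟨Q, rfl⟩ := (Submodule.mem_span_range_iff_exists_fun (D m)).mp hP
    exact HasSymbol.mem_span_range_of_sum_mul (isQuantization_normalOrderEquiv m)
      (hasKoszulSyzygies_LB m) (hasSymbol_ellB a b c) (hasSymbol_ellB_sub_euler a b c)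
      (ellB_sub_euler_mul_ellB a b c) (hasSymbol_initialForm _)
  · rintro _ ⟨i, rfl⟩
    exact Ideal.subset_span ⟨ellB a b c i, Ideal.subset_span ⟨i, rfl⟩,
      (initialForm_ellB a b c i).symm⟩

end Lauricella

end LauricellaFB

end

theorem mainTheorem6 (m : ℕ) (a b : Fin m → ℂ) (c : ℂ) :
    (∀ i : Fin m, LauricellaFB.initialForm (LauricellaFB.ellB a b c i) = LauricellaFB.LB i) ∧
      LauricellaFB.characteristicVariety (LauricellaFB.idealB a b c) =
        {p : Fin m ⊕ Fin m → ℂ | ∀ i : Fin m, MvPolynomial.eval p (LauricellaFB.LB i) = 0} := by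
  refine ⟨LauricellaFB.initialForm_ellB a b c, ?_⟩
  rw [LauricellaFB.characteristicVariety, LauricellaFB.initialIdeal_idealB,
    MvPolynomial.zeroLocus_span]
  simp
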